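/- Notation. Let $v_1,v_2$ be a basis of $\mathbb R^2$, $\Lambda=\mathbb Zv_1+\mathbb Zv_2$, and let the doubly periodic domain be $\Omega_c=\Omega_p=\{s v_1+t v_2: 0\le s,t<1\}$ (for the standard basis this is the unit square). Let $e_1,e_2\in\mathbb R^2$ be orthonormal, let $\rho_1,\rho_2:\mathbb R\to(0,\infty)$ be continuous and periodic with periods $T_1,T_2>0$, and suppose that $\rho(x)=\rho_1(x\cdot e_1)\,\rho_2(x\cdot e_2)$ is $\Lambda$-periodic. Put $$\theta=\frac{\int_{\Omega_p}\rho\,dx}{\int_{\Omega_c}d\xi},\qquad \theta_i=\frac1{T_i}\int_0^{T_i}\rho_i(s)\,ds,\qquad R_i(x)=\int_0^x\rho_i(s)\,ds\quad(i=1,2).$$ A doubly periodic solution of the Monge–Ampère equation is a function $P\in C^2(\mathbb R^2)$ with $\rho(\nabla P(\xi))\,\det D^2P(\xi)=\theta$ and $\nabla P(\xi+w)=\nabla P(\xi)+w$ for all $\xi\in\mathbb R^2$, $w\in\Lambda$, and $\nabla P(0)=0$. Theorem. We have $\theta=\theta_1\theta_2$, and $R_1,R_2:\mathbb R\to\mathbb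 R$ are bijective. There are functions $F,G:\mathbb R\to\mathbb R$ with $$F'(t)=R_1^{-1}(\theta_1t),\quad G'(t)=R_2^{-1}(\theta_2t),\quad F''(t)\,\rho_1(F'(t))=\theta_1,\quad G''(t)\,\rho_2(G'(t))=\theta_2,$$ $$F'(t+T_1)=F'(t)+T_1,\quad G'(t+T_2)=G'(t)+T_2$$ for all $t$, such that the separable function $$P(\xi)=F(\xi\cdot e_1)+G(\xi\cdot e_2)$$ is a doubly periodic solution; $P$ is convex, and the mesh map $\xi\mapsto\nabla P(\xi)$ is a bijection of $\mathbb R^2$. Every doubly periodic solution equals $P$ plus a constant. For every $\xi\in\mathbb R^2$, with $x=\nabla P(\xi)$, $\rho_1=\rho_1(x\cdot e_1)$, $\rho_2=\rho_2(x\cdot e_2)$, and $J=D^2P(\xi)$ the Jacobian matrix of the mesh map: 1. $x\cdot e_1=R_1^{-1}(\theta_1\,\xi\cdot e_1)$ and $x\cdot e_2=R_2^{-1}(\theta_2\,\xi\cdot e_2)$. 2. $J=\lambda_1e_1e_1^T+\lambda_2e_2e_2^T$ with $\lambda_i=\theta_i/\rho_i$; in particular $Je_i=\lambda_ie_i$.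 3. The metric tensor $M=\theta J^{-T}J^{-1}$ is the unique matrix with $J^TMJ=\theta I$, and $$M=\theta\left(\lambda_1^{-2}e_1e_1^T+\lambda_2^{-2}e_2e_2^T\right)=\frac{\theta_2\rho_1^2}{\theta_1}e_1e_1^T+\frac{\theta_1\rho_2^2}{\theta_2}e_2e_2^T ,$$ so that $Me_1=\frac{\theta_2\rho_1^2}{\theta_1}e_1$ and $Me_2=\frac{\theta_1\rho_2^2}{\theta_2}e_2$; moreover $\sqrt{\det M}=\rho(x)$. 4. (Alignment with the linear features.) For every $r>0$ the mesh element $\{y:(y-x)^TJ^{-T}J^{-1}(y-x)=r^2\}$ is the ellipse with centre $x$ and with semi-axes of lengths $r\lambda_1$ along $e_1$ and $r\lambda_2$ along $e_2$. The lines $\{y:y\cdot e_1=x\cdot e_1\}$ and $\{y:y\cdot e_2=x\cdot e_2\}$ are the lines through $x$ with direction $e_2$ and $e_1$ respectively, that is, parallel to these axes. Finally, for all $c,d\in\mathbb R$ the mesh map carries the line $\{\xi\cdot e_1=R_1(c)/\theta_1\}$ exactly onto the linear feature $\{x\cdot e_1=c\}$, and the line $\{\xi\cdot e_2=R_2(d)/\theta_2\}$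 exactly onto the linear feature $\{x\cdot e_2=d\}$. -/

import Mathlib

noncomputable section

open scoped InnerProductSpace Matrix

namespace MeshMA

/-- The Euclidean plane. -/
abbrev Plane : Type := EuclideanSpace ℝ (Fin 2)

/-- The period lattice generated by the two periods `b 0`, `b 1` of a doubly periodic domain. -/
def periodLattice (b : Module.Basis (Fin 2) ℝ Plane) : Submodule ℤ Plane :=
  Submodule.span ℤ (Set.range b)

/-- The period cell: the half-open parallelogram spanned by `b 0` and `b 1`
(the unit square `[0,1)²` when `b` is the standard basis). It represents both the computational
and the physical domain. -/
def periodCell (b : Module.Basis (Fin 2) ℝ Plane) : Set Plane :=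
  ZSpan.fundamentalDomain b

/-- `ρ` is doubly periodic, with the periods of the domain. -/
def IsDoublyPeriodic (b : Module.Basis (Fin 2) ℝ Plane) (ρ : Plane → ℝ) : Prop :=
  ∀ w ∈ periodLattice b, ∀ x, ρ (x + w) = ρ x

/-- The equidistribution constant `θ = ∫_{Ω_p} ρ dx / ∫_{Ω_c} dξ`. -/
def equidistConst (b : Module.Basis (Fin 2) ℝ Plane) (ρ : Plane → ℝ) : ℝ :=
  (∫ x in periodCell b, ρ x) / ∫ _ξ in periodCell b, (1 : ℝ)

/-- The Jacobian matrix `(∂ xᵢ / ∂ ξⱼ)` of a map of the plane. -/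
def jacobianMatrix (x : Plane → Plane) (ξ : Plane) : Matrix (Fin 2) (Fin 2) ℝ :=
  Matrix.of fun i j => (fderiv ℝ x ξ (EuclideanSpace.single j 1)) i

/-- The Hessian matrix of `P`, i.e. the Jacobian matrix of the mesh map `ξ ↦ ∇P(ξ)`. -/
def hessianMatrix (P : Plane → ℝ) (ξ : Plane) : Matrix (Fin 2) (Fin 2) ℝ :=
  jacobianMatrix (gradient P) ξ

/-- `P` is a classical solution of the Monge-Ampère equation `ρ(∇P) det D²P = θ` whose gradient
`x = ∇P` is a doubly periodic map of the domain: it commutes with the translations by periods, and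
it fixes the corner `0` of the period cell (hence every lattice point). -/
structure IsDoublyPeriodicSolution (b : Module.Basis (Fin 2) ℝ Plane) (ρ : Plane → ℝ)
    (P : Plane → ℝ) : Prop where
  contDiff : ContDiff ℝ 2 P
  mongeAmpere : ∀ ξ, ρ (gradient P ξ) * (hessianMatrix P ξ).det = equidistConst b ρ
  periodic : ∀ w ∈ periodLattice b, ∀ ξ, gradient P (ξ + w) = gradient P ξ + w
  fixes_zero : gradient P 0 = 0

/-- The cumulative density `R(x) = ∫₀ˣ ρ(s) ds`. -/
def cumulative (ρ : ℝ → ℝ) (x : ℝ) : ℝ := ∫ s in (0 : ℝ)..x, ρ s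

/-- The inverse function of `cumulative ρ` (it is the genuine inverse when that is bijective). -/
def cumulativeInv (ρ : ℝ → ℝ) : ℝ → ℝ := Function.invFun (cumulative ρ)

/-- The rank one matrix `u uᵀ`. -/
def outer (u : Plane) : Matrix (Fin 2) (Fin 2) ℝ := Matrix.vecMulVec u.ofLp u.ofLp

/-- The metric tensor `M = θ J⁻ᵀ J⁻¹` of a mesh map with Jacobian matrix `J`. -/
def metricTensor (θ : ℝ) (J : Matrix (Fin 2) (Fin 2) ℝ) : Matrix (Fin 2) (Fin 2) ℝ :=
  θ • ((J⁻¹)ᵀ * J⁻¹)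

/-- The mesh element at `x₀`: the linearised image of a circle of radius `r`, that is the ellipse
`(x - x₀)ᵀ J⁻ᵀ J⁻¹ (x - x₀) = r²`. -/
def meshElement (J : Matrix (Fin 2) (Fin 2) ℝ) (x₀ : Plane) (r : ℝ) : Set Plane :=
  {x | (x - x₀).ofLp ⬝ᵥ (((J⁻¹)ᵀ * J⁻¹) *ᵥ (x - x₀).ofLp) = r ^ 2}

/-- The ellipse with centre `x₀`, with semi-axis of length `α` along the unit vector `u`
and semi-axis of length `β` along the orthogonal unit vector `v`. -/
def axisEllipse (x₀ u v : Plane) (α β : ℝ) : Set Plane :=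
  {x | (⟪x - x₀, u⟫_ℝ / α) ^ 2 + (⟪x - x₀, v⟫_ℝ / β) ^ 2 = 1}

/-- The straight line `x · u = c`. -/
def featureLine (u : Plane) (c : ℝ) : Set Plane := {x | ⟪x, u⟫_ℝ = c}

end MeshMA

end

open scoped InnerProductSpace Matrix

/-! Existence decouples. Along each axis the equation `F'' ρ₁(F') = θ₁` integrates to `R₁(F'(t)) =
θ₁ t`, and `D²P` is then diagonal in the frame `e₁, e₂`, so its determinant is a product. The
lattice need not be aligned with the frame, and `w · eᵢ` need not be a multiple of `Tᵢ`. Periodicity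
of the product makes `ρᵢ` scale by a constant under translation by `w · eᵢ`; comparing integrals
over `[0, Tᵢ]` shows the constant is 1 (`periodic_left_factor`), and the same comparison gives `Rᵢ(x
+ w · eᵢ) = Rᵢ(x) + θᵢ w · eᵢ` (`cumulative_add_period`).

Uniqueness (`equidistDefect_eq_zero`) assumes no convexity of the competitor `Q`. The defects `Vᵢ =
Rᵢ(∇Q · eᵢ) - θᵢ ξ · eᵢ` are `C¹` and doubly periodic, so the weighted divergence `g = θ₁⁻¹ ∂₁V₁ +
θ₂⁻¹ ∂₂V₂` has zero integral over the cell. With `h = D²Q` in the frame and `α = ρ₁/θ₁`, `β =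
ρ₂/θ₂`, one has `g = α h₁₁ + β h₂₂ - 2`, while Monge–Ampère reads `α β det h = 1`. The
arithmetic–geometric inequality gives `(g + 2)² ≥ 4`, so by connectedness either `g ≥ 0` everywhere
or `g ≤ -4` everywhere. Zero integral leaves only `g = 0`, the equality case, which forces `DVᵢ =
0`. Since `∇Q(0) = 0`, both defects vanish and `∇Q` is determined. -/

namespace MeshMA

/-! ### One-dimensional equidistribution. -/

section OneDim

variable {ρ : ℝ → ℝ} {T θ : ℝ}

/-- The mean of a function over the interval `[0, T]`. -/
def IsMean (ρ : ℝ → ℝ) (T θ : ℝ) : Prop := θ = (∫ s in (0 : ℝ)..T, ρ s) / T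

theorem hasDerivAt_cumulative (hρ : Continuous ρ) (x : ℝ) :
    HasDerivAt (cumulative ρ) (ρ x) x :=
  intervalIntegral.integral_hasDerivAt_right (hρ.intervalIntegrable _ _)
    (hρ.stronglyMeasurableAtFilter _ _) hρ.continuousAt

theorem cumulative_zero : cumulative ρ 0 = 0 := by simp [cumulative]

theorem continuous_cumulative (hρ : Continuous ρ) : Continuous (cumulative ρ) :=
  continuous_iff_continuousAt.2 fun x => (hasDerivAt_cumulative hρ x).continuousAt

theorem strictMono_cumulative (hρ : Continuous ρ) (hpos : ∀ s, 0 < ρ s) :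
    StrictMono (cumulative ρ) :=
  strictMono_of_deriv_pos fun x => by
    rw [(hasDerivAt_cumulative hρ x).deriv]; exact hpos x

theorem mean_pos (hρ : Continuous ρ) (hpos : ∀ s, 0 < ρ s) (hT : 0 < T) (hθ : IsMean ρ T θ) :
    0 < θ := by
  rw [hθ]
  exact div_pos (intervalIntegral.intervalIntegral_pos_of_pos (hρ.intervalIntegrable _ _) hpos hT)
    hT

theorem mean_mul (hT : 0 < T) (hθ : IsMean ρ T θ) : θ * T = ∫ s in (0 : ℝ)..T, ρ s := by
  rw [hθ, div_mul_cancel₀ _ hT.ne']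

theorem bijective_cumulative (hρ : Continuous ρ) (hpos : ∀ s, 0 < ρ s) (hT : 0 < T)
    (hper : Function.Periodic ρ T) : Function.Bijective (cumulative ρ) := by
  have hI : 0 < ∫ s in (0 : ℝ)..T, ρ s :=
    intervalIntegral.intervalIntegral_pos_of_pos (hρ.intervalIntegrable _ _) hpos hT
  exact ⟨(strictMono_cumulative hρ hpos).injective, (continuous_cumulative hρ).surjective
    (hper.tendsto_atTop_intervalIntegral_of_pos hI hT)
    (hper.tendsto_atBot_intervalIntegral_of_pos hI hT)⟩

theorem cumulative_add (hρ : Continuous ρ) {a : ℝ} (ha : Function.Periodic ρ a) (x : ℝ) :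
    cumulative ρ (x + a) = cumulative ρ x + cumulative ρ a := by
  have h := ha.intervalIntegral_add_eq x 0
  have h2 := intervalIntegral.integral_add_adjacent_intervals
    (hρ.intervalIntegrable (μ := MeasureTheory.volume) 0 x) (hρ.intervalIntegrable x (x + a))
  rw [h, zero_add] at h2
  exact h2.symm

/-- A continuous function that is `T`-periodic and grows by a constant under a second translation
is invariant under that translation. -/
theorem periodic_of_add_const {f : ℝ → ℝ} (hf : Continuous f) (hT : 0 < T)
    (hper : Function.Periodic f T) {a κ : ℝ} (ha : ∀ x, f (x + a) = f x + κ) : κ = 0 := by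
  -- The integral of `f` over a full period is translation invariant, so the growth contributes `T *
  -- κ = 0`.
  have h1 : ∫ x in (0 : ℝ)..T, f (x + a) = ∫ x in (0 : ℝ)..T, f x := by
    rw [intervalIntegral.integral_comp_add_right f a, zero_add, add_comm T a,
      hper.intervalIntegral_add_eq a 0, zero_add]
  simp_rw [ha] at h1
  rw [intervalIntegral.integral_add (hf.intervalIntegrable _ _) (by simp)] at h1
  simp only [intervalIntegral.integral_const, sub_zero, smul_eq_mul, add_eq_left,
    mul_eq_zero] at h1
  exact h1.resolve_left hT.ne'

/-- A positive `T`-periodic function that is multiplied by a constant under a second translation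
is invariant under that translation. -/
theorem periodic_of_mul_const (hρ : Continuous ρ) (hpos : ∀ s, 0 < ρ s) (hT : 0 < T)
    (hper : Function.Periodic ρ T) {a c : ℝ} (ha : ∀ x, ρ (x + a) = c * ρ x) :
    Function.Periodic ρ a := by
  have h1 : ∫ x in (0 : ℝ)..T, ρ (x + a) = ∫ x in (0 : ℝ)..T, ρ x := by
    rw [intervalIntegral.integral_comp_add_right ρ a, zero_add, add_comm T a,
      hper.intervalIntegral_add_eq a 0, zero_add]
  have hI : 0 < ∫ s in (0 : ℝ)..T, ρ s :=
    intervalIntegral.intervalIntegral_pos_of_pos (hρ.intervalIntegrable _ _) hpos hT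
  simp_rw [ha] at h1
  rw [intervalIntegral.integral_const_mul] at h1
  have hc : c = 1 := mul_right_cancel₀ hI.ne' (by rw [h1, one_mul])
  intro x
  rw [ha, hc, one_mul]

/-- The period `a` may be incommensurable with `T`. Since `θ` is the mean over `T`, `cumulative ρ x
- θ * x` is `T`-periodic; translation by `a` adds a constant to it, which must be zero. -/
theorem cumulative_add_period (hρ : Continuous ρ) (hT : 0 < T)
    (hper : Function.Periodic ρ T) (hθ : IsMean ρ T θ) {a : ℝ} (ha : Function.Periodic ρ a) (x : ℝ) :
    cumulative ρ (x + a) = cumulative ρ x + θ * a := by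
  have hTT : cumulative ρ T = θ * T := (mean_mul hT hθ).symm
  have h := periodic_of_add_const (f := fun x => cumulative ρ x - θ * x) (a := a)
    (κ := cumulative ρ a - θ * a)
    ((continuous_cumulative hρ).sub (continuous_const.mul continuous_id)) hT
    (fun x => by simp only [cumulative_add hρ hper, hTT]; ring)
    (fun x => by simp only [cumulative_add hρ ha]; ring)
  rw [cumulative_add hρ ha]
  linarith

theorem cumulative_cumulativeInv (hb : Function.Bijective (cumulative ρ)) (y : ℝ) :
    cumulative ρ (cumulativeInv ρ y) = y :=
  Function.rightInverse_invFun hb.2 y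

theorem cumulativeInv_eq_iff (hb : Function.Bijective (cumulative ρ)) {x y : ℝ} :
    cumulativeInv ρ y = x ↔ cumulative ρ x = y :=
  ⟨fun h => h ▸ cumulative_cumulativeInv hb y,
    fun h => hb.1 (by rw [cumulative_cumulativeInv hb, h])⟩

/-- A strictly increasing surjection of `ℝ` is an order isomorphism, and these are homeomorphisms
for the order topology. -/
theorem continuous_cumulativeInv (hρ : Continuous ρ) (hpos : ∀ s, 0 < ρ s)
    (hb : Function.Bijective (cumulative ρ)) : Continuous (cumulativeInv ρ) := by
  have h : cumulativeInv ρ =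
      ((strictMono_cumulative hρ hpos).orderIsoOfSurjective _ hb.2).symm := by
    funext y
    rw [cumulativeInv_eq_iff hb]
    exact ((strictMono_cumulative hρ hpos).orderIsoOfSurjective _ hb.2).apply_symm_apply y
  rw [h]
  exact OrderIso.continuous _

theorem hasDerivAt_cumulativeInv (hρ : Continuous ρ) (hpos : ∀ s, 0 < ρ s)
    (hb : Function.Bijective (cumulative ρ)) (y : ℝ) :
    HasDerivAt (cumulativeInv ρ) (ρ (cumulativeInv ρ y))⁻¹ y :=
  (hasDerivAt_cumulative hρ _).of_local_left_inverse
    (continuous_cumulativeInv hρ hpos hb).continuousAt (hpos _).ne'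
    (Filter.Eventually.of_forall (cumulative_cumulativeInv hb))

/-- The one-dimensional mesh map `t ↦ R⁻¹(θ t)`. -/
noncomputable def meshMap (ρ : ℝ → ℝ) (θ t : ℝ) : ℝ := cumulativeInv ρ (θ * t)

theorem hasDerivAt_meshMap (hρ : Continuous ρ) (hpos : ∀ s, 0 < ρ s)
    (hb : Function.Bijective (cumulative ρ)) (t : ℝ) :
    HasDerivAt (meshMap ρ θ) (θ / ρ (meshMap ρ θ t)) t := by
  have h := (hasDerivAt_cumulativeInv hρ hpos hb (θ * t)).comp t
    ((hasDerivAt_id t).const_mul θ)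
  convert! h using 1
  simp [meshMap, div_eq_inv_mul]

theorem continuous_meshMap (hρ : Continuous ρ) (hpos : ∀ s, 0 < ρ s)
    (hb : Function.Bijective (cumulative ρ)) : Continuous (meshMap ρ θ) :=
  (continuous_cumulativeInv hρ hpos hb).comp (continuous_const.mul continuous_id)

theorem meshMap_eq_iff (hb : Function.Bijective (cumulative ρ)) {t x : ℝ} :
    meshMap ρ θ t = x ↔ cumulative ρ x = θ * t := cumulativeInv_eq_iff hb

theorem meshMap_add_period (hρ : Continuous ρ) (hT : 0 < T)
    (hper : Function.Periodic ρ T) (hθ : IsMean ρ T θ) (hb : Function.Bijective (cumulative ρ))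
    {a : ℝ} (ha : Function.Periodic ρ a) (t : ℝ) :
    meshMap ρ θ (t + a) = meshMap ρ θ t + a := by
  rw [meshMap_eq_iff hb, cumulative_add_period hρ hT hper hθ ha, (meshMap_eq_iff hb).1 rfl, mul_add]

theorem meshMap_zero (hb : Function.Bijective (cumulative ρ)) : meshMap ρ θ 0 = 0 := by
  rw [meshMap_eq_iff hb, cumulative_zero, mul_zero]

theorem strictMono_meshMap (hρ : Continuous ρ) (hpos : ∀ s, 0 < ρ s)
    (hb : Function.Bijective (cumulative ρ)) (hθ : 0 < θ) : StrictMono (meshMap ρ θ) :=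
  strictMono_of_deriv_pos fun t => by
    rw [(hasDerivAt_meshMap hρ hpos hb t).deriv]; exact div_pos hθ (hpos _)

/-- The potential `F` with `F'(t) = R⁻¹(θ t)`. -/
noncomputable def potential (ρ : ℝ → ℝ) (θ t : ℝ) : ℝ := ∫ s in (0 : ℝ)..t, meshMap ρ θ s

theorem hasDerivAt_potential (hρ : Continuous ρ) (hpos : ∀ s, 0 < ρ s)
    (hb : Function.Bijective (cumulative ρ)) (t : ℝ) :
    HasDerivAt (potential ρ θ) (meshMap ρ θ t) t :=
  have hc := continuous_meshMap hρ hpos hb (θ := θ)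
  intervalIntegral.integral_hasDerivAt_right (hc.intervalIntegrable _ _)
    (hc.stronglyMeasurableAtFilter _ _) hc.continuousAt

theorem deriv_potential (hρ : Continuous ρ) (hpos : ∀ s, 0 < ρ s)
    (hb : Function.Bijective (cumulative ρ)) : deriv (potential ρ θ) = meshMap ρ θ :=
  funext fun t => (hasDerivAt_potential hρ hpos hb t).deriv

/-- Continuity of `ρ` suffices: `R⁻¹(θ t)` has the continuous derivative `θ / ρ`, and the potential
gains one more order. -/
theorem contDiff_potential (hρ : Continuous ρ) (hpos : ∀ s, 0 < ρ s)
    (hb : Function.Bijective (cumulative ρ)) : ContDiff ℝ 2 (potential ρ θ) := by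
  have h1 : ContDiff ℝ 1 (meshMap ρ θ) := by
    rw [contDiff_one_iff_deriv]
    refine ⟨fun t => (hasDerivAt_meshMap hρ hpos hb t).differentiableAt, ?_⟩
    rw [show deriv (meshMap ρ θ) = fun t => θ / ρ (meshMap ρ θ t) from
      funext fun t => (hasDerivAt_meshMap hρ hpos hb t).deriv]
    exact continuous_const.div (hρ.comp (continuous_meshMap hρ hpos hb)) fun t => (hpos _).ne'
  rw [show (2 : WithTop ℕ∞) = 1 + 1 by norm_num, contDiff_succ_iff_deriv]
  refine ⟨fun t => (hasDerivAt_potential hρ hpos hb t).differentiableAt, by simp, ?_⟩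
  rwa [deriv_potential hρ hpos hb]

theorem convexOn_potential (hρ : Continuous ρ) (hpos : ∀ s, 0 < ρ s)
    (hb : Function.Bijective (cumulative ρ)) (hθ : 0 < θ) :
    ConvexOn ℝ Set.univ (potential ρ θ) := by
  refine Monotone.convexOn_univ_of_deriv
    (fun t => (hasDerivAt_potential hρ hpos hb t).differentiableAt) ?_
  rw [deriv_potential hρ hpos hb]
  exact (strictMono_meshMap hρ hpos hb hθ).monotone

end OneDim

end MeshMA

namespace MeshMA

open MeasureTheory

/-! ### Integrals over the period cell. -/

section Lattice

variable {b : Module.Basis (Fin 2) ℝ Plane} {f : Plane → ℝ}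

/-- The translate of the cell by any vector, in the lattice or not, is again a fundamental domain,
and the integral of an invariant function is the same over all of them. -/
theorem setIntegral_periodCell_add (hf : IsDoublyPeriodic b f) (h : Plane) :
    ∫ x in periodCell b, f (x + h) = ∫ x in periodCell b, f x := by
  have hd : IsAddFundamentalDomain (periodLattice b).toAddSubgroup (periodCell b)
    (volume : Measure Plane) := ZSpan.isAddFundamentalDomain' b volume
  have hinv : ∀ (g : (periodLattice b).toAddSubgroup) (x : Plane), f (g +ᵥ x) = f x := by
    intro g x
    rw [AddSubgroup.vadd_def, vadd_eq_add, add_comm]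
    exact hf _ g.2 x
  have hc : Countable (periodLattice b).toAddSubgroup :=
    inferInstanceAs (Countable (Submodule.span ℤ (Set.range b)))
  have hvi : VAddInvariantMeasure (periodLattice b).toAddSubgroup Plane volume := inferInstance
  rw [hd.setIntegral_eq (hd.vadd_of_comm h) hinv]
  rw [← (measurePreserving_add_right volume h).setIntegral_image_emb
    (measurableEmbedding_addRight h)]
  congr 2
  ext x
  simp only [Set.image_add_right, Set.mem_preimage, Set.mem_vadd_set, vadd_eq_add]
  exact ⟨fun hx => ⟨_, hx, by abel⟩, fun ⟨y, hy, hyx⟩ => by rwa [← hyx, add_comm h, add_neg_cancel_right]⟩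

theorem isBounded_periodCell : Bornology.IsBounded (periodCell b) :=
  ZSpan.fundamentalDomain_isBounded b

theorem integrableOn_periodCell (hf : Continuous f) : IntegrableOn f (periodCell b) :=
  (hf.locallyIntegrable.integrableOn_isCompact isBounded_periodCell.isCompact_closure).mono_set
    subset_closure

theorem setIntegral_one_periodCell_pos : 0 < ∫ _ξ in periodCell b, (1 : ℝ) := by
  simp only [integral_const, smul_eq_mul, mul_one, measureReal_restrict_apply_univ]
  refine ENNReal.toReal_pos (ZSpan.measure_fundamentalDomain_ne_zero b) ?_
  exact isBounded_periodCell.measure_lt_top.ne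

/-- Averaging a continuous doubly periodic function along segments does not change its integral
over the period cell. -/
theorem setIntegral_intervalIntegral_periodCell (hf : Continuous f) (hp : IsDoublyPeriodic b f)
    (e : Plane) (L : ℝ) :
    ∫ x in periodCell b, (∫ s in (0 : ℝ)..L, f (x + s • e)) = L * ∫ x in periodCell b, f x := by
  -- After Fubini the inner integral over the cell does not depend on `s`.
  rw [← intervalIntegral_integral_swap]
  · simp_rw [setIntegral_periodCell_add hp]
    simp
  · have hc : Continuous (Function.uncurry fun (s : ℝ) (x : Plane) => f (x + s • e)) := by
      unfold Function.uncurry; fun_prop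
    rw [Measure.prod_restrict]
    have hK : IsCompact (Set.uIcc 0 L ×ˢ closure (periodCell b)) :=
      isCompact_uIcc.prod isBounded_periodCell.isCompact_closure
    exact (hc.locallyIntegrable.integrableOn_isCompact hK).mono_set
      (Set.prod_mono Set.uIoc_subset_uIcc subset_closure)

theorem isDoublyPeriodic_fderiv {V : Plane → ℝ} (hp : IsDoublyPeriodic b V) (e : Plane) :
    IsDoublyPeriodic b fun x => fderiv ℝ V x e := by
  intro w hw x
  have : (fun y => V (y + w)) = V := funext (hp w hw)
  change fderiv ℝ V (x + w) e = fderiv ℝ V x e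
  rw [← fderiv_comp_add_right, this]

/-- The directional derivative of a doubly periodic function has zero integral over the cell. -/
theorem setIntegral_fderiv_periodCell {V : Plane → ℝ} (hV : ContDiff ℝ 1 V)
    (hp : IsDoublyPeriodic b V) (e : Plane) :
    ∫ x in periodCell b, fderiv ℝ V x e = 0 := by
  have hc : Continuous fun x => fderiv ℝ V x e :=
    (hV.continuous_fderiv one_ne_zero).clm_apply continuous_const
  -- Averaging over a segment of length parameter 1 turns the derivative into `V (x + e) - V x`,
  -- whose cell integral is zero.
  have h := setIntegral_intervalIntegral_periodCell hc (isDoublyPeriodic_fderiv hp e) e 1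
  have hi : ∀ x, ∫ s in (0 : ℝ)..1, fderiv ℝ V (x + s • e) e = V (x + e) - V x := by
    intro x
    have hd : ∀ s ∈ Set.uIcc (0 : ℝ) 1,
        HasDerivAt (fun s : ℝ => V (x + s • e)) (fderiv ℝ V (x + s • e) e) s := by
      intro s _
      have h1 : HasDerivAt (fun s : ℝ => x + s • e) e s := by
        simpa using ((hasDerivAt_id s).smul_const e).const_add x
      exact ((hV.differentiable one_ne_zero) _).hasFDerivAt.comp_hasDerivAt s h1
    rw [intervalIntegral.integral_eq_sub_of_hasDerivAt hd]
    · simp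
    · exact (hc.comp (by fun_prop : Continuous fun s : ℝ => x + s • e)).intervalIntegrable _ _
  simp_rw [hi] at h
  rw [one_mul, integral_sub, setIntegral_periodCell_add hp, sub_self] at h
  · exact h.symm
  · exact integrableOn_periodCell (hV.continuous.comp (by fun_prop))
  · exact integrableOn_periodCell hV.continuous

/-- A nonnegative continuous doubly periodic function with zero integral over the cell vanishes. -/
theorem eq_zero_of_setIntegral_periodCell (hf : Continuous f) (hp : IsDoublyPeriodic b f)
    (h0 : ∀ x, 0 ≤ f x) (hi : ∫ x in periodCell b, f x = 0) (x : Plane) : f x = 0 := by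
  have hd : IsAddFundamentalDomain (periodLattice b).toAddSubgroup (periodCell b)
    (volume : Measure Plane) := ZSpan.isAddFundamentalDomain' b volume
  have hc : Countable (periodLattice b).toAddSubgroup :=
    inferInstanceAs (Countable (Submodule.span ℤ (Set.range b)))
  have hae := (setIntegral_eq_zero_iff_of_nonneg_ae (Filter.Eventually.of_forall h0)
    (integrableOn_periodCell hf)).1 hi
  have hm : MeasurableSet {x | f x ≠ 0} := (measurableSet_eq_fun hf.measurable measurable_const).compl
  have h1 : volume ({x | f x ≠ 0} ∩ periodCell b) = 0 := by
    rw [← Measure.restrict_apply hm]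
    exact hae
  -- The set where `f ≠ 0` is lattice-invariant, so being null in the cell makes it null in the
  -- plane; continuity then excludes it altogether.
  have h2 : volume {x | f x ≠ 0} = 0 := by
    refine hd.measure_zero_of_invariant _ (fun g => ?_) h1
    ext y
    rw [Set.mem_vadd_set_iff_neg_vadd_mem, AddSubgroup.vadd_def, vadd_eq_add, add_comm]
    simp only [Set.mem_ofPred_eq]
    rw [hp _ (-g).2 y]
  have h3 : f =ᵐ[volume] fun _ => 0 := h2
  exact congrFun ((hf.ae_eq_iff_eq volume continuous_const).1 h3) x

end Lattice

end MeshMA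

namespace MeshMA

/-! ### Linear algebra in an orthonormal frame. -/

section Frame

variable {e₁ e₂ : Plane}

theorem inner_eq_coord (u v : Plane) : ⟪u, v⟫_ℝ = u 0 * v 0 + u 1 * v 1 := by
  simp [PiLp.inner_apply, Fin.sum_univ_two, mul_comm]

theorem Frame.inner_self_left (he : Orthonormal ℝ ![e₁, e₂]) : ⟪e₁, e₁⟫_ℝ = 1 := by
  rw [real_inner_self_eq_norm_sq, show ‖e₁‖ = 1 from he.1 0, one_pow]

theorem Frame.inner_self_right (he : Orthonormal ℝ ![e₁, e₂]) : ⟪e₂, e₂⟫_ℝ = 1 := by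
  rw [real_inner_self_eq_norm_sq, show ‖e₂‖ = 1 from he.1 1, one_pow]

theorem Frame.inner_left_right (he : Orthonormal ℝ ![e₁, e₂]) : ⟪e₁, e₂⟫_ℝ = 0 :=
  he.2 (i := 0) (j := 1) (by decide)

theorem Frame.inner_right_left (he : Orthonormal ℝ ![e₁, e₂]) : ⟪e₂, e₁⟫_ℝ = 0 :=
  he.2 (i := 1) (j := 0) (by decide)

/-- Lagrange's identity: an orthonormal frame has determinant `±1`. The square is what enters the
determinant formulas. -/
theorem Frame.cross_sq (he : Orthonormal ℝ ![e₁, e₂]) :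
    (e₁ 0 * e₂ 1 - e₁ 1 * e₂ 0) ^ 2 = 1 := by
  have h1 := Frame.inner_self_left he
  have h2 := Frame.inner_self_right he
  have h3 := Frame.inner_left_right he
  rw [inner_eq_coord] at h1 h2 h3
  linear_combination (e₂ 0 * e₂ 0 + e₂ 1 * e₂ 1) * h1 + h2 -
    (e₁ 0 * e₂ 0 + e₁ 1 * e₂ 1) * h3

theorem outer_mulVec (u v : Plane) : outer u *ᵥ v.ofLp = ⟪v, u⟫_ℝ • u.ofLp := by
  ext i
  simp only [outer, Matrix.mulVec, dotProduct, Matrix.vecMulVec_apply, Fin.sum_univ_two,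
    inner_eq_coord, Pi.smul_apply, smul_eq_mul]
  ring

theorem outer_mul_outer (u v : Plane) :
    outer u * outer v = ⟪u, v⟫_ℝ • Matrix.vecMulVec u.ofLp v.ofLp := by
  ext i j
  simp only [outer, Matrix.mul_apply, Matrix.vecMulVec_apply, Fin.sum_univ_two,
    inner_eq_coord, Matrix.smul_apply, smul_eq_mul]
  ring

theorem transpose_outer (u : Plane) : (outer u)ᵀ = outer u := by
  simp [outer, Matrix.transpose_vecMulVec]

theorem outer_add_outer (he : Orthonormal ℝ ![e₁, e₂]) : outer e₁ + outer e₂ = 1 := by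
  have h1 := Frame.inner_self_left he
  have h2 := Frame.inner_self_right he
  have h3 := Frame.inner_left_right he
  rw [inner_eq_coord] at h1 h2 h3
  have hU : (!![e₁ 0, e₁ 1; e₂ 0, e₂ 1] : Matrix (Fin 2) (Fin 2) ℝ) *
      !![e₁ 0, e₂ 0; e₁ 1, e₂ 1] = 1 := by
    rw [Matrix.mul_fin_two, Matrix.one_fin_two, h1, h2, h3]
    rw [show e₂ 0 * e₁ 0 + e₂ 1 * e₁ 1 = 0 by linarith]
  -- Orthonormal rows give `U Uᵀ = 1`; the reversed product `Uᵀ U = 1` is the resolution of the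
  -- identity.
  rw [mul_eq_one_comm] at hU
  rw [← hU]
  ext i j
  fin_cases i <;> fin_cases j <;> simp [outer, Matrix.vecMulVec_apply, Matrix.mul_apply]

theorem frame_expansion (he : Orthonormal ℝ ![e₁, e₂]) (x : Plane) :
    x = ⟪x, e₁⟫_ℝ • e₁ + ⟪x, e₂⟫_ℝ • e₂ := by
  apply WithLp.ofLp_injective
  rw [WithLp.ofLp_add, WithLp.ofLp_smul, WithLp.ofLp_smul, ← outer_mulVec, ← outer_mulVec,
    ← Matrix.add_mulVec, outer_add_outer he, Matrix.one_mulVec]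

theorem Frame.inner_combination_left (he : Orthonormal ℝ ![e₁, e₂]) (s t : ℝ) :
    ⟪s • e₁ + t • e₂, e₁⟫_ℝ = s := by
  rw [inner_add_left, real_inner_smul_left, real_inner_smul_left, Frame.inner_self_left he,
    Frame.inner_right_left he]; ring

theorem Frame.inner_combination_right (he : Orthonormal ℝ ![e₁, e₂]) (s t : ℝ) :
    ⟪s • e₁ + t • e₂, e₂⟫_ℝ = t := by
  rw [inner_add_left, real_inner_smul_left, real_inner_smul_left, Frame.inner_self_right he,
    Frame.inner_left_right he]; ring

theorem Frame.ext (he : Orthonormal ℝ ![e₁, e₂]) {x y : Plane} (h1 : ⟪x, e₁⟫_ℝ = ⟪y, e₁⟫_ℝ)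
    (h2 : ⟪x, e₂⟫_ℝ = ⟪y, e₂⟫_ℝ) : x = y := by
  rw [frame_expansion he x, frame_expansion he y, h1, h2]

/-- The matrix with eigenvectors `u`, `v` and eigenvalues `α`, `β`. -/
def frameDiagonal (u v : Plane) (α β : ℝ) : Matrix (Fin 2) (Fin 2) ℝ := α • outer u + β • outer v

/-- Matrices diagonal in the frame multiply entrywise, which reduces the inverse, metric tensor and
mesh element to scalar computations. -/
theorem frameDiagonal_mul (he : Orthonormal ℝ ![e₁, e₂]) (α β α' β' : ℝ) :
    frameDiagonal e₁ e₂ α β * frameDiagonal e₁ e₂ α' β' =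
      frameDiagonal e₁ e₂ (α * α') (β * β') := by
  simp only [frameDiagonal, add_mul, mul_add, Matrix.smul_mul, Matrix.mul_smul, outer_mul_outer,
    Frame.inner_self_left he, Frame.inner_self_right he, Frame.inner_left_right he,
    Frame.inner_right_left he, smul_smul]
  simp [outer, mul_comm]

theorem frameDiagonal_one (he : Orthonormal ℝ ![e₁, e₂]) : frameDiagonal e₁ e₂ 1 1 = 1 := by
  rw [frameDiagonal, one_smul, one_smul, outer_add_outer he]

theorem smul_frameDiagonal (c α β : ℝ) :
    c • frameDiagonal e₁ e₂ α β = frameDiagonal e₁ e₂ (c * α) (c * β) := by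
  simp only [frameDiagonal, smul_add, smul_smul]

theorem transpose_frameDiagonal (α β : ℝ) :
    (frameDiagonal e₁ e₂ α β)ᵀ = frameDiagonal e₁ e₂ α β := by
  simp [frameDiagonal, transpose_outer]

theorem inv_frameDiagonal (he : Orthonormal ℝ ![e₁, e₂]) {α β : ℝ} (hα : α ≠ 0) (hβ : β ≠ 0) :
    (frameDiagonal e₁ e₂ α β)⁻¹ = frameDiagonal e₁ e₂ α⁻¹ β⁻¹ := by
  apply Matrix.inv_eq_right_inv
  rw [frameDiagonal_mul he, mul_inv_cancel₀ hα, mul_inv_cancel₀ hβ, frameDiagonal_one he]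

theorem det_frameDiagonal (he : Orthonormal ℝ ![e₁, e₂]) (α β : ℝ) :
    (frameDiagonal e₁ e₂ α β).det = α * β := by
  have h := Frame.cross_sq he
  simp only [frameDiagonal, outer, Matrix.det_fin_two, Matrix.add_apply, Matrix.smul_apply,
    Matrix.vecMulVec_apply, smul_eq_mul]
  linear_combination α * β * h

theorem frameDiagonal_mulVec (x : Plane) (α β : ℝ) :
    frameDiagonal e₁ e₂ α β *ᵥ x.ofLp =
      ((α * ⟪x, e₁⟫_ℝ) • e₁ + (β * ⟪x, e₂⟫_ℝ) • e₂ : Plane).ofLp := by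
  simp only [frameDiagonal, Matrix.add_mulVec, Matrix.smul_mulVec, outer_mulVec, smul_smul,
    WithLp.ofLp_add, WithLp.ofLp_smul]

theorem frameDiagonal_mulVec_left (he : Orthonormal ℝ ![e₁, e₂]) (α β : ℝ) :
    frameDiagonal e₁ e₂ α β *ᵥ e₁.ofLp = α • e₁.ofLp := by
  rw [frameDiagonal_mulVec, Frame.inner_self_left he, Frame.inner_left_right he]; simp

theorem frameDiagonal_mulVec_right (he : Orthonormal ℝ ![e₁, e₂]) (α β : ℝ) :
    frameDiagonal e₁ e₂ α β *ᵥ e₂.ofLp = β • e₂.ofLp := by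
  rw [frameDiagonal_mulVec, Frame.inner_self_right he, Frame.inner_right_left he]; simp

theorem metricTensor_frameDiagonal (he : Orthonormal ℝ ![e₁, e₂]) {α β : ℝ} (hα : α ≠ 0)
    (hβ : β ≠ 0) (θ : ℝ) :
    metricTensor θ (frameDiagonal e₁ e₂ α β) =
      θ • frameDiagonal e₁ e₂ (α ^ 2)⁻¹ (β ^ 2)⁻¹ := by
  rw [metricTensor, inv_frameDiagonal he hα hβ, transpose_frameDiagonal, frameDiagonal_mul he,
    ← mul_inv, ← mul_inv, pow_two, pow_two]

/-- The metric tensor is the only matrix `N` with `Jᵀ N J = θ I`. -/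
theorem transpose_mul_mul_eq_smul_one_iff {J : Matrix (Fin 2) (Fin 2) ℝ} (hJ : IsUnit J.det)
    (θ : ℝ) (N : Matrix (Fin 2) (Fin 2) ℝ) :
    Jᵀ * N * J = θ • (1 : Matrix (Fin 2) (Fin 2) ℝ) ↔ N = metricTensor θ J := by
  have h1 : J * J⁻¹ = 1 := Matrix.mul_nonsing_inv J hJ
  have h2 : J⁻¹ * J = 1 := Matrix.nonsing_inv_mul J hJ
  have h3 : Jᵀ * (J⁻¹)ᵀ = 1 := by rw [← Matrix.transpose_mul, h2, Matrix.transpose_one]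
  have h4 : (J⁻¹)ᵀ * Jᵀ = 1 := by rw [← Matrix.transpose_mul, h1, Matrix.transpose_one]
  constructor
  · intro h
    calc N = ((J⁻¹)ᵀ * Jᵀ) * N * (J * J⁻¹) := by rw [h1, h4, one_mul, mul_one]
      _ = (J⁻¹)ᵀ * (Jᵀ * N * J) * J⁻¹ := by simp only [Matrix.mul_assoc]
      _ = metricTensor θ J := by rw [h, metricTensor]; simp
  · rintro rfl
    calc Jᵀ * metricTensor θ J * J = θ • ((Jᵀ * (J⁻¹)ᵀ) * (J⁻¹ * J)) := by
          simp only [metricTensor, Matrix.mul_smul, Matrix.smul_mul, Matrix.mul_assoc]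
      _ = θ • (1 : Matrix (Fin 2) (Fin 2) ℝ) := by rw [h2, h3, one_mul]

theorem ofLp_dotProduct_ofLp (u v : Plane) : u.ofLp ⬝ᵥ v.ofLp = ⟪u, v⟫_ℝ := by
  rw [inner_eq_coord, dotProduct, Fin.sum_univ_two]

theorem meshElement_frameDiagonal (he : Orthonormal ℝ ![e₁, e₂]) {α β : ℝ} (hα : α ≠ 0)
    (hβ : β ≠ 0) (x : Plane) {r : ℝ} (hr : 0 < r) :
    meshElement (frameDiagonal e₁ e₂ α β) x r = axisEllipse x e₁ e₂ (r * α) (r * β) := by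
  ext y
  simp only [meshElement, axisEllipse, Set.mem_ofPred_eq]
  rw [inv_frameDiagonal he hα hβ, transpose_frameDiagonal, frameDiagonal_mul he,
    frameDiagonal_mulVec, ofLp_dotProduct_ofLp, inner_add_right, real_inner_smul_right,
    real_inner_smul_right]
  have hr2 : r ^ 2 ≠ 0 := by positivity
  rw [← div_eq_one_iff_eq hr2]
  have : ∀ p q : ℝ, (α⁻¹ * α⁻¹ * p * p + β⁻¹ * β⁻¹ * q * q) / r ^ 2 =
      (p / (r * α)) ^ 2 + (q / (r * β)) ^ 2 := by
    intro p q
    field_simp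
  rw [this]

theorem featureLine_left_eq (he : Orthonormal ℝ ![e₁, e₂]) (x : Plane) :
    featureLine e₁ ⟪x, e₁⟫_ℝ =
      (AffineSubspace.mk' x (Submodule.span ℝ {e₂}) : Set Plane) := by
  ext y
  simp only [featureLine, Set.mem_ofPred_eq, SetLike.mem_coe, AffineSubspace.mem_mk',
    vsub_eq_sub, Submodule.mem_span_singleton]
  constructor
  · intro h
    refine ⟨⟪y - x, e₂⟫_ℝ, ?_⟩
    conv_rhs => rw [frame_expansion he (y - x)]
    rw [inner_sub_left y x e₁, h, sub_self, zero_smul, zero_add]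
  · rintro ⟨a, ha⟩
    rw [← sub_eq_zero, ← inner_sub_left, ← ha, real_inner_smul_left, Frame.inner_right_left he,
      mul_zero]

theorem Frame.symm (he : Orthonormal ℝ ![e₁, e₂]) : Orthonormal ℝ ![e₂, e₁] := by
  have h := he.comp (Equiv.swap (0 : Fin 2) 1) (Equiv.injective _)
  convert! h using 1
  ext i
  fin_cases i <;> simp

theorem featureLine_right_eq (he : Orthonormal ℝ ![e₁, e₂]) (x : Plane) :
    featureLine e₂ ⟪x, e₂⟫_ℝ =
      (AffineSubspace.mk' x (Submodule.span ℝ {e₁}) : Set Plane) :=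
  featureLine_left_eq (Frame.symm he) x

theorem jacobianMatrix_mulVec (x : Plane → Plane) (ξ v : Plane) :
    jacobianMatrix x ξ *ᵥ v.ofLp = (fderiv ℝ x ξ v).ofLp := by
  have hv : v = v 0 • EuclideanSpace.single (0 : Fin 2) (1 : ℝ) +
      v 1 • EuclideanSpace.single (1 : Fin 2) (1 : ℝ) := by
    ext i; fin_cases i <;> simp
  conv_rhs => rw [hv]
  ext i
  rw [map_add, map_smul, map_smul]
  simp [jacobianMatrix, Matrix.mulVec, dotProduct, Fin.sum_univ_two, mul_comm]

theorem jacobianMatrix_eq_frameDiagonal {x : Plane → Plane} {ξ : Plane} {α β : ℝ}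
    (h : ∀ v, fderiv ℝ x ξ v = (α * ⟪v, e₁⟫_ℝ) • e₁ + (β * ⟪v, e₂⟫_ℝ) • e₂) :
    jacobianMatrix x ξ = frameDiagonal e₁ e₂ α β := by
  apply Matrix.ext_of_mulVec_single
  intro i
  have hs : (Pi.single i (1 : ℝ) : Fin 2 → ℝ) = (EuclideanSpace.single i (1 : ℝ) : Plane).ofLp := by
    simp
  rw [hs, jacobianMatrix_mulVec, frameDiagonal_mulVec, h]

theorem det_jacobianMatrix (he : Orthonormal ℝ ![e₁, e₂]) (x : Plane → Plane) (ξ : Plane) :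
    (jacobianMatrix x ξ).det =
      ⟪fderiv ℝ x ξ e₁, e₁⟫_ℝ * ⟪fderiv ℝ x ξ e₂, e₂⟫_ℝ -
        ⟪fderiv ℝ x ξ e₁, e₂⟫_ℝ * ⟪fderiv ℝ x ξ e₂, e₁⟫_ℝ := by
  have h := Frame.cross_sq he
  simp only [← ofLp_dotProduct_ofLp, ← jacobianMatrix_mulVec]
  generalize jacobianMatrix x ξ = J
  simp only [Matrix.det_fin_two, Matrix.mulVec, dotProduct, Fin.sum_univ_two]
  linear_combination -(J 0 0 * J 1 1 - J 0 1 * J 1 0) * h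

end Frame

/-! ### Lattice periodicity of the factors and the value of the constant. -/

section Factors

variable {e₁ e₂ : Plane} {ρ₁ ρ₂ : ℝ → ℝ} {T₁ T₂ θ₁ θ₂ : ℝ} {b : Module.Basis (Fin 2) ℝ Plane}
  {ρ : Plane → ℝ}

theorem periodic_left_factor (he : Orthonormal ℝ ![e₁, e₂]) (hρ₁ : Continuous ρ₁)
    (hpos₁ : ∀ s, 0 < ρ₁ s) (hpos₂ : ∀ s, 0 < ρ₂ s) (hT₁ : 0 < T₁)
    (hper₁ : Function.Periodic ρ₁ T₁) (hρ : ∀ x, ρ x = ρ₁ ⟪x, e₁⟫_ℝ * ρ₂ ⟪x, e₂⟫_ℝ)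
    (hper : IsDoublyPeriodic b ρ) {w : Plane} (hw : w ∈ periodLattice b) :
    Function.Periodic ρ₁ ⟪w, e₁⟫_ℝ := by
  -- Periodicity of `ρ` at the points `s e₁` reads `ρ₁(s + w · e₁) ρ₂(w · e₂) = ρ₁(s) ρ₂(0)`, whence
  -- the ratio `c`.
  refine periodic_of_mul_const hρ₁ hpos₁ hT₁ hper₁ (c := ρ₂ 0 / ρ₂ ⟪w, e₂⟫_ℝ) fun s => ?_
  have h := hper w hw (s • e₁ + (0 : ℝ) • e₂)
  rw [hρ, hρ, inner_add_left _ w, inner_add_left _ w, Frame.inner_combination_left he,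
    Frame.inner_combination_right he, zero_add] at h
  have := (hpos₂ ⟪w, e₂⟫_ℝ).ne'
  field_simp
  linarith

theorem periodic_right_factor (he : Orthonormal ℝ ![e₁, e₂]) (hρ₂ : Continuous ρ₂)
    (hpos₁ : ∀ s, 0 < ρ₁ s) (hpos₂ : ∀ s, 0 < ρ₂ s) (hT₂ : 0 < T₂)
    (hper₂ : Function.Periodic ρ₂ T₂) (hρ : ∀ x, ρ x = ρ₁ ⟪x, e₁⟫_ℝ * ρ₂ ⟪x, e₂⟫_ℝ)
    (hper : IsDoublyPeriodic b ρ) {w : Plane} (hw : w ∈ periodLattice b) :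
    Function.Periodic ρ₂ ⟪w, e₂⟫_ℝ :=
  periodic_left_factor (Frame.symm he) hρ₂ hpos₂ hpos₁ hT₂ hper₂
    (fun x => by rw [hρ, mul_comm]) hper hw

theorem isDoublyPeriodic_comp_inner {f : ℝ → ℝ} {e : Plane}
    (h : ∀ w ∈ periodLattice b, Function.Periodic f ⟪w, e⟫_ℝ) :
    IsDoublyPeriodic b fun x => f ⟪x, e⟫_ℝ := fun w hw x => by
  change f ⟪x + w, e⟫_ℝ = f ⟪x, e⟫_ℝ
  rw [inner_add_left, h w hw]

/-- Averaging over length `T₁` along `e₁` replaces `ρ` by `θ₁ ρ₂`, and averaging over `T₂` along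
`e₂` replaces `ρ₂` by `θ₂`. Neither average changes the cell integral, although these segments need
not be lattice vectors. -/
theorem equidistConst_eq_mul (he : Orthonormal ℝ ![e₁, e₂]) (hρ₁ : Continuous ρ₁)
    (hρ₂ : Continuous ρ₂) (hT₁ : 0 < T₁) (hT₂ : 0 < T₂)
    (hper₁ : Function.Periodic ρ₁ T₁) (hper₂ : Function.Periodic ρ₂ T₂)
    (hρ : ∀ x, ρ x = ρ₁ ⟪x, e₁⟫_ℝ * ρ₂ ⟪x, e₂⟫_ℝ) (hper : IsDoublyPeriodic b ρ)
    (hlat₂ : ∀ w ∈ periodLattice b, Function.Periodic ρ₂ ⟪w, e₂⟫_ℝ)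
    (hθ₁ : IsMean ρ₁ T₁ θ₁) (hθ₂ : IsMean ρ₂ T₂ θ₂) :
    equidistConst b ρ = θ₁ * θ₂ := by
  have hc : Continuous ρ := by rw [funext hρ]; fun_prop
  have h1 := setIntegral_intervalIntegral_periodCell hc hper e₁ T₁
  have h2 := setIntegral_intervalIntegral_periodCell (f := fun x => ρ₂ ⟪x, e₂⟫_ℝ)
    (by fun_prop) (isDoublyPeriodic_comp_inner hlat₂) e₂ T₂
  have i1 : ∀ x : Plane, ∫ s in (0 : ℝ)..T₁, ρ (x + s • e₁) = θ₁ * T₁ * ρ₂ ⟪x, e₂⟫_ℝ := by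
    intro x
    simp_rw [hρ, inner_add_left, real_inner_smul_left, Frame.inner_self_left he,
      Frame.inner_left_right he, mul_zero, add_zero, mul_one]
    rw [intervalIntegral.integral_mul_const, intervalIntegral.integral_comp_add_left ρ₁, add_zero,
      hper₁.intervalIntegral_add_eq _ 0, zero_add, mean_mul hT₁ hθ₁]
  have i2 : ∀ x : Plane, ∫ s in (0 : ℝ)..T₂, ρ₂ ⟪x + s • e₂, e₂⟫_ℝ = θ₂ * T₂ * 1 := by
    intro x
    simp_rw [inner_add_left, real_inner_smul_left, Frame.inner_self_right he, mul_one]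
    rw [intervalIntegral.integral_comp_add_left ρ₂, add_zero,
      hper₂.intervalIntegral_add_eq _ 0, zero_add, mean_mul hT₂ hθ₂]
  simp_rw [i1] at h1
  simp_rw [i2] at h2
  rw [MeasureTheory.integral_const_mul] at h1 h2
  have hA := setIntegral_one_periodCell_pos (b := b)
  rw [equidistConst, div_eq_iff hA.ne']
  apply mul_left_cancel₀ hT₁.ne'
  apply mul_left_cancel₀ hT₂.ne'
  linear_combination -T₂ * h1 - T₁ * θ₁ * h2

end Factors

/-! ### Gradient and Hessian of a separable function. -/

section Separable

variable {e₁ e₂ : Plane} {F G F' G' : ℝ → ℝ} {P : Plane → ℝ}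

theorem hasGradientAt_comp_inner {f : ℝ → ℝ} {f' : ℝ} {e ξ : Plane}
    (hf : HasDerivAt f f' ⟪ξ, e⟫_ℝ) : HasGradientAt (fun η => f ⟪η, e⟫_ℝ) (f' • e) ξ := by
  rw [hasGradientAt_iff_hasFDerivAt]
  have h1 : HasFDerivAt (fun η : Plane => ⟪η, e⟫_ℝ) (innerSL ℝ e) ξ := by
    rw [show (fun η : Plane => ⟪η, e⟫_ℝ) = innerSL ℝ e from
      funext fun η => (real_inner_comm _ _)]
    exact (innerSL ℝ e).hasFDerivAt
  have h2 := hf.comp_hasFDerivAt ξ h1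
  convert! h2 using 1
  ext v
  simp

theorem gradient_separable (hP : ∀ ξ, P ξ = F ⟪ξ, e₁⟫_ℝ + G ⟪ξ, e₂⟫_ℝ)
    (hF : ∀ t, HasDerivAt F (F' t) t) (hG : ∀ t, HasDerivAt G (G' t) t) :
    gradient P = fun ξ => F' ⟪ξ, e₁⟫_ℝ • e₁ + G' ⟪ξ, e₂⟫_ℝ • e₂ := by
  rw [funext hP]
  refine gradient_eq fun ξ => ?_
  have h1 := (hasGradientAt_comp_inner (e := e₁) (hF ⟪ξ, e₁⟫_ℝ)).hasFDerivAt
  have h2 := (hasGradientAt_comp_inner (e := e₂) (hG ⟪ξ, e₂⟫_ℝ)).hasFDerivAt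
  rw [hasGradientAt_iff_hasFDerivAt, map_add]
  exact h1.add h2

theorem hessianMatrix_separable {α β : ℝ} {ξ : Plane}
    (hP : gradient P = fun ξ => F' ⟪ξ, e₁⟫_ℝ • e₁ + G' ⟪ξ, e₂⟫_ℝ • e₂)
    (hF : HasDerivAt F' α ⟪ξ, e₁⟫_ℝ) (hG : HasDerivAt G' β ⟪ξ, e₂⟫_ℝ) :
    hessianMatrix P ξ = frameDiagonal e₁ e₂ α β := by
  have h := ((hasGradientAt_comp_inner hF).hasFDerivAt.smul_const e₁).add
    ((hasGradientAt_comp_inner hG).hasFDerivAt.smul_const e₂)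
  refine jacobianMatrix_eq_frameDiagonal fun v => ?_
  rw [hP]
  erw [h.fderiv]
  simp [real_inner_comm]

end Separable

end MeshMA

namespace MeshMA

/-! ### Uniqueness of doubly periodic solutions. -/

section Uniqueness

/-- Given the determinant condition, the square of the trace minus 4 equals `(α h₁₁ - β h₂₂)² + 4 α
β h₁₂²`. -/
theorem sq_trace_ge_four {α β h₁₁ h₁₂ h₂₂ : ℝ} (hα : 0 < α) (hβ : 0 < β)
    (hdet : α * β * (h₁₁ * h₂₂ - h₁₂ * h₁₂) = 1) : 4 ≤ (α * h₁₁ + β * h₂₂) ^ 2 := by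
  have h1 : 0 ≤ α * β * (h₁₂ * h₁₂) := mul_nonneg (by positivity) (mul_self_nonneg _)
  linear_combination (-4) * hdet + 4 * h1 + sq_nonneg (α * h₁₁ - β * h₂₂)

theorem eq_one_of_trace_eq_two {α β h₁₁ h₁₂ h₂₂ : ℝ} (hα : 0 < α) (hβ : 0 < β)
    (hdet : α * β * (h₁₁ * h₂₂ - h₁₂ * h₁₂) = 1) (htr : α * h₁₁ + β * h₂₂ = 2) :
    h₁₂ = 0 ∧ α * h₁₁ = 1 ∧ β * h₂₂ = 1 := by
  have h1 : 4 * (α * β) * h₁₂ ^ 2 + (α * h₁₁ - β * h₂₂) ^ 2 = 0 := by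
    linear_combination (-4) * hdet + (α * h₁₁ + β * h₂₂ + 2) * htr
  have h2 : 0 ≤ 4 * (α * β) * h₁₂ ^ 2 := by positivity
  have h3 := sq_nonneg (α * h₁₁ - β * h₂₂)
  have h4 : 4 * (α * β) * h₁₂ ^ 2 = 0 := by linarith
  have h5 : (α * h₁₁ - β * h₂₂) ^ 2 = 0 := by linarith
  have h6 : h₁₂ = 0 := by
    have : 4 * (α * β) ≠ 0 := by positivity
    exact pow_eq_zero_iff two_ne_zero |>.1 ((mul_eq_zero.1 h4).resolve_left this)
  have h7 := pow_eq_zero_iff two_ne_zero |>.1 h5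
  exact ⟨h6, by linarith, by linarith⟩

variable {Q : Plane → ℝ}

theorem inner_gradient_eq_fderiv (ξ v : Plane) : ⟪gradient Q ξ, v⟫_ℝ = fderiv ℝ Q ξ v := by
  rw [gradient, InnerProductSpace.toDual_symm_apply]

theorem contDiff_gradient (hQ : ContDiff ℝ 2 Q) : ContDiff ℝ 1 (gradient Q) :=
  (InnerProductSpace.toDual ℝ Plane).symm.contDiff.comp
    (hQ.fderiv_right (m := 1) (by norm_num))

theorem inner_fderiv_gradient_symm (hQ : ContDiff ℝ 2 Q) (ξ u v : Plane) :
    ⟪fderiv ℝ (gradient Q) ξ u, v⟫_ℝ = ⟪fderiv ℝ (gradient Q) ξ v, u⟫_ℝ := by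
  have key : ∀ u v : Plane, ⟪fderiv ℝ (gradient Q) ξ u, v⟫_ℝ = fderiv ℝ (fderiv ℝ Q) ξ u v := by
    intro u v
    have h1 := ((contDiff_gradient hQ).differentiable one_ne_zero ξ).hasFDerivAt.inner ℝ
      (hasFDerivAt_const v ξ)
    have h2 := ((hQ.fderiv_right (m := 1) (by norm_num)).differentiable
      one_ne_zero ξ).hasFDerivAt.clm_apply (hasFDerivAt_const v ξ)
    simp_rw [inner_gradient_eq_fderiv] at h1
    have h3 := DFunLike.congr_fun (h1.unique h2) u
    simpa using h3
  rw [key, key]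
  exact hQ.contDiffAt.isSymmSndFDerivAt (by simp) u v

/-- The deviation `R(∇Q · e) - θ ξ · e` of a mesh map from the one-dimensional equidistribution in
direction `e`. -/
noncomputable def equidistDefect (ρ : ℝ → ℝ) (θ : ℝ) (Q : Plane → ℝ) (e ξ : Plane) : ℝ :=
  cumulative ρ ⟪gradient Q ξ, e⟫_ℝ - θ * ⟪ξ, e⟫_ℝ

variable {ρ : ℝ → ℝ} {θ : ℝ} {e : Plane}

theorem contDiff_equidistDefect (hρ : Continuous ρ) (hQ : ContDiff ℝ 2 Q) :
    ContDiff ℝ 1 (equidistDefect ρ θ Q e) := by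
  have hR : ContDiff ℝ 1 (cumulative ρ) := by
    rw [contDiff_one_iff_deriv, show deriv (cumulative ρ) = ρ from
      funext fun x => (hasDerivAt_cumulative hρ x).deriv]
    exact ⟨fun x => (hasDerivAt_cumulative hρ x).differentiableAt, hρ⟩
  exact (hR.comp ((contDiff_gradient hQ).inner ℝ contDiff_const)).sub
    (contDiff_const.mul (contDiff_id.inner ℝ contDiff_const))

theorem fderiv_equidistDefect (hρ : Continuous ρ) (hQ : ContDiff ℝ 2 Q) (ξ v : Plane) :
    fderiv ℝ (equidistDefect ρ θ Q e) ξ v =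
      ρ ⟪gradient Q ξ, e⟫_ℝ * ⟪fderiv ℝ (gradient Q) ξ v, e⟫_ℝ - θ * ⟪v, e⟫_ℝ := by
  have h1 := ((contDiff_gradient hQ).differentiable one_ne_zero ξ).hasFDerivAt.inner ℝ
    (hasFDerivAt_const e ξ)
  have h2 := (hasDerivAt_cumulative hρ ⟪gradient Q ξ, e⟫_ℝ).comp_hasFDerivAt ξ h1
  have h3 := ((hasFDerivAt_id ξ).inner ℝ (hasFDerivAt_const e ξ)).const_mul θ
  have h4 := (h2.sub h3).fderiv
  have h5 : fderiv ℝ (equidistDefect ρ θ Q e) ξ = _ := h4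
  rw [h5]
  simp

/-- The growth of `cumulative ρ` along a lattice vector cancels exactly that of the linear term. -/
theorem isDoublyPeriodic_equidistDefect {b : Module.Basis (Fin 2) ℝ Plane}
    (hR : ∀ w ∈ periodLattice b, ∀ x, cumulative ρ (x + ⟪w, e⟫_ℝ) = cumulative ρ x + θ * ⟪w, e⟫_ℝ)
    (hQ : ∀ w ∈ periodLattice b, ∀ ξ, gradient Q (ξ + w) = gradient Q ξ + w) :
    IsDoublyPeriodic b (equidistDefect ρ θ Q e) := by
  intro w hw ξ
  simp only [equidistDefect]
  rw [hQ w hw, inner_add_left, inner_add_left, hR w hw]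
  ring

variable {e₁ e₂ : Plane} {ρ₁ ρ₂ : ℝ → ℝ} {θ₁ θ₂ : ℝ} {b : Module.Basis (Fin 2) ℝ Plane}
  {ρ : Plane → ℝ}

theorem eq_zero_of_fderiv_eq_zero {V : Plane → ℝ} (he : Orthonormal ℝ ![e₁, e₂])
    (hV : Differentiable ℝ V) (h₁ : ∀ ξ, fderiv ℝ V ξ e₁ = 0) (h₂ : ∀ ξ, fderiv ℝ V ξ e₂ = 0)
    (h0 : V 0 = 0) (ξ : Plane) : V ξ = 0 := by
  rw [← h0]
  refine is_const_of_fderiv_eq_zero (𝕜 := ℝ) hV (fun η => ?_) ξ 0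
  ext v
  rw [frame_expansion he v, map_add, map_smul, map_smul, h₁, h₂]
  simp

/-- A mesh map equidistributing a separable density equidistributes each of its factors. -/
theorem equidistDefect_eq_zero (he : Orthonormal ℝ ![e₁, e₂]) (hρ₁ : Continuous ρ₁)
    (hρ₂ : Continuous ρ₂) (hpos₁ : ∀ s, 0 < ρ₁ s) (hpos₂ : ∀ s, 0 < ρ₂ s)
    (hθ₁ : 0 < θ₁) (hθ₂ : 0 < θ₂) (hρ : ∀ x, ρ x = ρ₁ ⟪x, e₁⟫_ℝ * ρ₂ ⟪x, e₂⟫_ℝ)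
    (hθ : equidistConst b ρ = θ₁ * θ₂)
    (hR₁ : ∀ w ∈ periodLattice b, ∀ x,
      cumulative ρ₁ (x + ⟪w, e₁⟫_ℝ) = cumulative ρ₁ x + θ₁ * ⟪w, e₁⟫_ℝ)
    (hR₂ : ∀ w ∈ periodLattice b, ∀ x,
      cumulative ρ₂ (x + ⟪w, e₂⟫_ℝ) = cumulative ρ₂ x + θ₂ * ⟪w, e₂⟫_ℝ)
    (hQ : IsDoublyPeriodicSolution b ρ Q) (ξ : Plane) :
    equidistDefect ρ₁ θ₁ Q e₁ ξ = 0 ∧ equidistDefect ρ₂ θ₂ Q e₂ ξ = 0 := by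
  set V₁ := equidistDefect ρ₁ θ₁ Q e₁ with hV₁
  set V₂ := equidistDefect ρ₂ θ₂ Q e₂ with hV₂
  have hc₁ : ContDiff ℝ 1 V₁ := contDiff_equidistDefect hρ₁ hQ.contDiff
  have hc₂ : ContDiff ℝ 1 V₂ := contDiff_equidistDefect hρ₂ hQ.contDiff
  have hp₁ : IsDoublyPeriodic b V₁ := isDoublyPeriodic_equidistDefect hR₁ hQ.periodic
  have hp₂ : IsDoublyPeriodic b V₂ := isDoublyPeriodic_equidistDefect hR₂ hQ.periodic
  -- These weights normalise the Monge–Ampère equation to right-hand side 1.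
  let α : Plane → ℝ := fun η => ρ₁ ⟪gradient Q η, e₁⟫_ℝ / θ₁
  let β : Plane → ℝ := fun η => ρ₂ ⟪gradient Q η, e₂⟫_ℝ / θ₂
  let H : Plane → Plane → Plane → ℝ := fun η u v => ⟪fderiv ℝ (gradient Q) η u, v⟫_ℝ
  have hα : ∀ η, 0 < α η := fun η => div_pos (hpos₁ _) hθ₁
  have hβ : ∀ η, 0 < β η := fun η => div_pos (hpos₂ _) hθ₂
  have hsymm : ∀ η, H η e₂ e₁ = H η e₁ e₂ := fun η => inner_fderiv_gradient_symm hQ.contDiff η _ _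
  have hdet : ∀ η, α η * β η * (H η e₁ e₁ * H η e₂ e₂ - H η e₁ e₂ * H η e₁ e₂) = 1 := by
    intro η
    have h := hQ.mongeAmpere η
    rw [hessianMatrix, det_jacobianMatrix he, hρ, hθ] at h
    change _ * (H η e₁ e₁ * H η e₂ e₂ - H η e₁ e₂ * H η e₂ e₁) = _ at h
    rw [hsymm] at h
    simp only [α, β]
    field_simp
    linarith
  have hd₁ : ∀ η v, fderiv ℝ V₁ η v = θ₁ * (α η * H η v e₁ - ⟪v, e₁⟫_ℝ) := by
    intro η v
    rw [hV₁, fderiv_equidistDefect hρ₁ hQ.contDiff]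
    simp only [α, H]
    field_simp
  have hd₂ : ∀ η v, fderiv ℝ V₂ η v = θ₂ * (β η * H η v e₂ - ⟪v, e₂⟫_ℝ) := by
    intro η v
    rw [hV₂, fderiv_equidistDefect hρ₂ hQ.contDiff]
    simp only [β, H]
    field_simp
  let g : Plane → ℝ := fun η => θ₁⁻¹ * fderiv ℝ V₁ η e₁ + θ₂⁻¹ * fderiv ℝ V₂ η e₂
  have hg : ∀ η, g η = α η * H η e₁ e₁ + β η * H η e₂ e₂ - 2 := by
    intro η
    simp only [g]
    rw [hd₁, hd₂, Frame.inner_self_left he, Frame.inner_self_right he,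
      inv_mul_cancel_left₀ hθ₁.ne', inv_mul_cancel_left₀ hθ₂.ne']
    ring
  have hf₁ : Continuous fun η => fderiv ℝ V₁ η e₁ :=
    (hc₁.continuous_fderiv one_ne_zero).clm_apply continuous_const
  have hf₂ : Continuous fun η => fderiv ℝ V₂ η e₂ :=
    (hc₂.continuous_fderiv one_ne_zero).clm_apply continuous_const
  have hgc : Continuous g := (continuous_const.mul hf₁).add (continuous_const.mul hf₂)
  have hgp : IsDoublyPeriodic b g := by
    intro w hw η
    have h₁ := isDoublyPeriodic_fderiv hp₁ e₁ w hw η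
    have h₂ := isDoublyPeriodic_fderiv hp₂ e₂ w hw η
    simp only [g, h₁, h₂]
  have hgi : ∫ η in periodCell b, g η = 0 := by
    simp only [g]
    rw [MeasureTheory.integral_add ((integrableOn_periodCell hf₁).const_mul _)
      ((integrableOn_periodCell hf₂).const_mul _), MeasureTheory.integral_const_mul,
      MeasureTheory.integral_const_mul, setIntegral_fderiv_periodCell hc₁ hp₁,
      setIntegral_fderiv_periodCell hc₂ hp₂]
    simp
  -- Here `(g + 2)² ≥ 4`. The second alternative corresponds to a negative definite Hessian, which
  -- the determinant alone does not exclude.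
  have hdich : ∀ η, 0 ≤ g η ∨ g η ≤ -4 := by
    intro η
    have h := sq_trace_ge_four (hα η) (hβ η) (hdet η)
    rw [show α η * H η e₁ e₁ + β η * H η e₂ e₂ = g η + 2 by rw [hg]; ring] at h
    by_contra! hcon
    nlinarith
  have hg0 : ∀ η, g η = 0 := by
    by_cases hex : ∃ η, g η ≤ -4
    · have hall : ∀ η, g η ≤ -4 := by
        intro η
        by_contra hη
        -- Any level strictly between `-4` and `0` would do: the plane is connected, so a continuous
        -- `g` taking values on both sides would attain it.
        obtain ⟨ζ, hζ⟩ := mem_range_of_exists_le_of_exists_ge hgc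
          (c := -2) (hex.imp fun _ h => by linarith)
          ⟨η, by linarith [(hdich η).resolve_right hη]⟩
        rcases hdich ζ with h | h <;> linarith
      -- If `g ≤ -4` everywhere, then `-g` is nonnegative with zero integral, hence zero: a
      -- contradiction at the origin.
      have h := eq_zero_of_setIntegral_periodCell (f := fun η => -g η) hgc.neg
        (fun w hw η => by simp only [hgp w hw η]) (fun η => by linarith [hall η])
        (by rw [MeasureTheory.integral_neg, hgi, neg_zero]) 0
      linarith [hall 0]
    · push Not at hex
      exact eq_zero_of_setIntegral_periodCell hgc hgp
        (fun η => (hdich η).resolve_right (not_le.2 (hex η))) hgi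
  have hone : ∀ η, H η e₁ e₂ = 0 ∧ α η * H η e₁ e₁ = 1 ∧ β η * H η e₂ e₂ = 1 := fun η =>
    eq_one_of_trace_eq_two (hα η) (hβ η) (hdet η) (by linarith [hg η, hg0 η])
  have hz : ∀ (τ : ℝ → ℝ) (c : ℝ) (e : Plane), equidistDefect τ c Q e 0 = 0 := by
    intro τ c e
    simp [equidistDefect, hQ.fixes_zero, cumulative_zero]
  refine ⟨eq_zero_of_fderiv_eq_zero he (hc₁.differentiable one_ne_zero) (fun η => ?_)
    (fun η => ?_) (hz _ _ _) ξ, eq_zero_of_fderiv_eq_zero he (hc₂.differentiable one_ne_zero)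
    (fun η => ?_) (fun η => ?_) (hz _ _ _) ξ⟩
  · rw [hd₁, (hone η).2.1, Frame.inner_self_left he]; ring
  · rw [hd₁, hsymm, (hone η).1, Frame.inner_right_left he]; ring
  · rw [hd₂, (hone η).1, Frame.inner_left_right he]; ring
  · rw [hd₂, (hone η).2.2, Frame.inner_self_right he]; ring

theorem exists_eq_add_const_of_gradient_eq {P Q : Plane → ℝ} (hP : Differentiable ℝ P)
    (hQ : Differentiable ℝ Q) (h : ∀ ξ, gradient Q ξ = gradient P ξ) :
    ∃ k : ℝ, ∀ ξ, Q ξ = P ξ + k := by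
  refine ⟨Q 0 - P 0, fun ξ => ?_⟩
  have hd : ∀ η, fderiv ℝ (fun η => Q η - P η) η = 0 := by
    intro η
    rw [fderiv_fun_sub (hQ η) (hP η), sub_eq_zero]
    ext v
    rw [← inner_gradient_eq_fderiv, ← inner_gradient_eq_fderiv, h]
  have hc : Q ξ - P ξ = Q 0 - P 0 := is_const_of_fderiv_eq_zero (𝕜 := ℝ) (hQ.sub hP) hd ξ 0
  linarith

end Uniqueness

end MeshMA

namespace MeshMA

/-! ### The separable solution and its mesh map. -/

section SeparableSolution

variable {e₁ e₂ : Plane} {ρ₁ ρ₂ : ℝ → ℝ} {T₁ T₂ θ₁ θ₂ : ℝ} {b : Module.Basis (Fin 2) ℝ Plane}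
  {ρ : Plane → ℝ}

/-- The separable potential `F(ξ · u) + G(ξ · v)` built from the one-dimensional potentials. -/
noncomputable def separablePotential (u v : Plane) (ρ₁ ρ₂ : ℝ → ℝ) (θ₁ θ₂ : ℝ) (ξ : Plane) : ℝ :=
  potential ρ₁ θ₁ ⟪ξ, u⟫_ℝ + potential ρ₂ θ₂ ⟪ξ, v⟫_ℝ

theorem separablePotential_apply (u v : Plane) (ρ₁ ρ₂ : ℝ → ℝ) (θ₁ θ₂ : ℝ) (ξ : Plane) :
    separablePotential u v ρ₁ ρ₂ θ₁ θ₂ ξ =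
      potential ρ₁ θ₁ ⟪ξ, u⟫_ℝ + potential ρ₂ θ₂ ⟪ξ, v⟫_ℝ := rfl

theorem gradient_separablePotential (hρ₁ : Continuous ρ₁) (hρ₂ : Continuous ρ₂)
    (hpos₁ : ∀ s, 0 < ρ₁ s) (hpos₂ : ∀ s, 0 < ρ₂ s) (hb₁ : Function.Bijective (cumulative ρ₁))
    (hb₂ : Function.Bijective (cumulative ρ₂)) :
    gradient (separablePotential e₁ e₂ ρ₁ ρ₂ θ₁ θ₂) =
      fun ξ => meshMap ρ₁ θ₁ ⟪ξ, e₁⟫_ℝ • e₁ + meshMap ρ₂ θ₂ ⟪ξ, e₂⟫_ℝ • e₂ :=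
  gradient_separable (separablePotential_apply e₁ e₂ ρ₁ ρ₂ θ₁ θ₂)
    (hasDerivAt_potential hρ₁ hpos₁ hb₁) (hasDerivAt_potential hρ₂ hpos₂ hb₂)

theorem isDoublyPeriodicSolution_separablePotential (he : Orthonormal ℝ ![e₁, e₂])
    (hρ₁ : Continuous ρ₁) (hρ₂ : Continuous ρ₂) (hpos₁ : ∀ s, 0 < ρ₁ s) (hpos₂ : ∀ s, 0 < ρ₂ s)
    (hT₁ : 0 < T₁) (hT₂ : 0 < T₂)
    (hper₁ : Function.Periodic ρ₁ T₁) (hper₂ : Function.Periodic ρ₂ T₂)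
    (hρ : ∀ x, ρ x = ρ₁ ⟪x, e₁⟫_ℝ * ρ₂ ⟪x, e₂⟫_ℝ) (hθ : equidistConst b ρ = θ₁ * θ₂)
    (hlat₁ : ∀ w ∈ periodLattice b, Function.Periodic ρ₁ ⟪w, e₁⟫_ℝ)
    (hlat₂ : ∀ w ∈ periodLattice b, Function.Periodic ρ₂ ⟪w, e₂⟫_ℝ)
    (hθ₁ : IsMean ρ₁ T₁ θ₁) (hθ₂ : IsMean ρ₂ T₂ θ₂) :
    IsDoublyPeriodicSolution b ρ (separablePotential e₁ e₂ ρ₁ ρ₂ θ₁ θ₂) := by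
  have hb₁ := bijective_cumulative hρ₁ hpos₁ hT₁ hper₁
  have hb₂ := bijective_cumulative hρ₂ hpos₂ hT₂ hper₂
  have hgrad := gradient_separablePotential (e₁ := e₁) (e₂ := e₂) (θ₁ := θ₁) (θ₂ := θ₂)
    hρ₁ hρ₂ hpos₁ hpos₂ hb₁ hb₂
  refine ⟨?_, fun ξ => ?_, fun w hw ξ => ?_, ?_⟩
  · exact ((contDiff_potential hρ₁ hpos₁ hb₁).comp (contDiff_id.inner ℝ contDiff_const)).add
      ((contDiff_potential hρ₂ hpos₂ hb₂).comp (contDiff_id.inner ℝ contDiff_const))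
  · rw [hessianMatrix_separable hgrad (hasDerivAt_meshMap hρ₁ hpos₁ hb₁ _)
      (hasDerivAt_meshMap hρ₂ hpos₂ hb₂ _), det_frameDiagonal he, hρ, hgrad,
      Frame.inner_combination_left he, Frame.inner_combination_right he, hθ]
    have h₁ := (hpos₁ (meshMap ρ₁ θ₁ ⟪ξ, e₁⟫_ℝ)).ne'
    have h₂ := (hpos₂ (meshMap ρ₂ θ₂ ⟪ξ, e₂⟫_ℝ)).ne'
    field_simp
  · apply Frame.ext he
    · rw [hgrad, Frame.inner_combination_left he, inner_add_left, inner_add_left,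
        Frame.inner_combination_left he, meshMap_add_period hρ₁ hT₁ hper₁ hθ₁ hb₁ (hlat₁ w hw)]
    · rw [hgrad, Frame.inner_combination_right he, inner_add_left, inner_add_left,
        Frame.inner_combination_right he, meshMap_add_period hρ₂ hT₂ hper₂ hθ₂ hb₂ (hlat₂ w hw)]
  · simp [hgrad, meshMap_zero hb₁, meshMap_zero hb₂]

theorem convexOn_separablePotential (hρ₁ : Continuous ρ₁) (hρ₂ : Continuous ρ₂)
    (hpos₁ : ∀ s, 0 < ρ₁ s) (hpos₂ : ∀ s, 0 < ρ₂ s) (hb₁ : Function.Bijective (cumulative ρ₁))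
    (hb₂ : Function.Bijective (cumulative ρ₂)) (hθ₁ : 0 < θ₁) (hθ₂ : 0 < θ₂) :
    ConvexOn ℝ Set.univ (separablePotential e₁ e₂ ρ₁ ρ₂ θ₁ θ₂) := by
  have h : ∀ {f : ℝ → ℝ} (e : Plane), ConvexOn ℝ Set.univ f →
      ConvexOn ℝ Set.univ fun ξ : Plane => f ⟪ξ, e⟫_ℝ := fun e hf =>
    hf.comp_linearMap ((innerₗ Plane).flip e)
  exact (h e₁ (convexOn_potential hρ₁ hpos₁ hb₁ hθ₁)).add
    (h e₂ (convexOn_potential hρ₂ hpos₂ hb₂ hθ₂))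

theorem bijective_gradient_separablePotential (he : Orthonormal ℝ ![e₁, e₂])
    (hρ₁ : Continuous ρ₁) (hρ₂ : Continuous ρ₂) (hpos₁ : ∀ s, 0 < ρ₁ s) (hpos₂ : ∀ s, 0 < ρ₂ s)
    (hb₁ : Function.Bijective (cumulative ρ₁)) (hb₂ : Function.Bijective (cumulative ρ₂))
    (hθ₁ : θ₁ ≠ 0) (hθ₂ : θ₂ ≠ 0) :
    Function.Bijective (gradient (separablePotential e₁ e₂ ρ₁ ρ₂ θ₁ θ₂)) := by
  rw [gradient_separablePotential hρ₁ hρ₂ hpos₁ hpos₂ hb₁ hb₂]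
  constructor
  · intro ξ η h
    have h₁ := congrArg (fun z => ⟪z, e₁⟫_ℝ) h
    have h₂ := congrArg (fun z => ⟪z, e₂⟫_ℝ) h
    simp only [Frame.inner_combination_left he, Frame.inner_combination_right he] at h₁ h₂
    rw [meshMap_eq_iff hb₁, (meshMap_eq_iff hb₁).1 rfl] at h₁
    rw [meshMap_eq_iff hb₂, (meshMap_eq_iff hb₂).1 rfl] at h₂
    exact Frame.ext he (mul_left_cancel₀ hθ₁ h₁).symm (mul_left_cancel₀ hθ₂ h₂).symm
  · intro x
    refine ⟨(cumulative ρ₁ ⟪x, e₁⟫_ℝ / θ₁) • e₁ + (cumulative ρ₂ ⟪x, e₂⟫_ℝ / θ₂) • e₂, ?_⟩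
    apply Frame.ext he
    · rw [Frame.inner_combination_left he, Frame.inner_combination_left he, meshMap_eq_iff hb₁,
        mul_div_cancel₀ _ hθ₁]
    · rw [Frame.inner_combination_right he, Frame.inner_combination_right he, meshMap_eq_iff hb₂,
        mul_div_cancel₀ _ hθ₂]

/-- The feature line pulls back to the whole given line, and surjectivity of `m` makes the image
fill the feature line. -/
theorem image_featureLine {τ : ℝ → ℝ} {θ : ℝ} {e : Plane} {m : Plane → Plane}
    (hb : Function.Bijective (cumulative τ)) (hθ : θ ≠ 0) (hm : Function.Surjective m)
    (h : ∀ ξ, ⟪m ξ, e⟫_ℝ = meshMap τ θ ⟪ξ, e⟫_ℝ) (c : ℝ) :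
    m '' featureLine e (cumulative τ c / θ) = featureLine e c := by
  have hpre : featureLine e (cumulative τ c / θ) = m ⁻¹' featureLine e c := by
    ext ξ
    simp only [featureLine, Set.mem_ofPred_eq, Set.mem_preimage]
    rw [h, meshMap_eq_iff hb, eq_div_iff hθ, mul_comm, eq_comm]
  rw [hpre, Set.image_preimage_eq _ hm]

end SeparableSolution

end MeshMA

/-! ### Assembly of the theorem. -/

theorem theorem3p1
    (b : Module.Basis (Fin 2) ℝ MeshMA.Plane)
    (e₁ e₂ : MeshMA.Plane) (he : Orthonormal ℝ ![e₁, e₂])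
    (ρ₁ ρ₂ : ℝ → ℝ) (hρ₁ : Continuous ρ₁) (hρ₂ : Continuous ρ₂)
    (hpos₁ : ∀ s, 0 < ρ₁ s) (hpos₂ : ∀ s, 0 < ρ₂ s)
    (T₁ T₂ : ℝ) (hT₁ : 0 < T₁) (hT₂ : 0 < T₂)
    (hper₁ : Function.Periodic ρ₁ T₁) (hper₂ : Function.Periodic ρ₂ T₂)
    (ρ : MeshMA.Plane → ℝ) (hρ : ∀ x, ρ x = ρ₁ ⟪x, e₁⟫_ℝ * ρ₂ ⟪x, e₂⟫_ℝ)
    (hper : MeshMA.IsDoublyPeriodic b ρ)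
    (θ θ₁ θ₂ : ℝ) (hθ : θ = MeshMA.equidistConst b ρ)
    (hθ₁ : θ₁ = (∫ s in (0 : ℝ)..T₁, ρ₁ s) / T₁)
    (hθ₂ : θ₂ = (∫ s in (0 : ℝ)..T₂, ρ₂ s) / T₂) :
    θ = θ₁ * θ₂ ∧
    Function.Bijective (MeshMA.cumulative ρ₁) ∧
    Function.Bijective (MeshMA.cumulative ρ₂) ∧
    ∃ (F G : ℝ → ℝ) (P : MeshMA.Plane → ℝ),
      (∀ ξ, P ξ = F ⟪ξ, e₁⟫_ℝ + G ⟪ξ, e₂⟫_ℝ) ∧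
      -- the two one-dimensional problems solved by `F` and `G`
      (∀ t, HasDerivAt F (MeshMA.cumulativeInv ρ₁ (θ₁ * t)) t) ∧
      (∀ t, HasDerivAt G (MeshMA.cumulativeInv ρ₂ (θ₂ * t)) t) ∧
      (∀ t, deriv (deriv F) t * ρ₁ (deriv F t) = θ₁) ∧
      (∀ t, deriv (deriv G) t * ρ₂ (deriv G t) = θ₂) ∧
      (∀ t, deriv F (t + T₁) = deriv F t + T₁) ∧
      (∀ t, deriv G (t + T₂) = deriv G t + T₂) ∧
      -- `P` is a convex doubly periodic solution, and `x = ∇P` is an invertible map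
      MeshMA.IsDoublyPeriodicSolution b ρ P ∧
      ConvexOn ℝ Set.univ P ∧
      Function.Bijective (gradient P) ∧
      -- uniqueness up to a constant, among all doubly periodic solutions
      (∀ Q : MeshMA.Plane → ℝ, MeshMA.IsDoublyPeriodicSolution b ρ Q →
        ∃ k : ℝ, ∀ ξ, Q ξ = P ξ + k) ∧
      -- the explicit map, its Jacobian matrix and its metric tensor
      (∀ ξ x : MeshMA.Plane, ∀ J M : Matrix (Fin 2) (Fin 2) ℝ, ∀ r₁ r₂ : ℝ,
        x = gradient P ξ → J = MeshMA.hessianMatrix P ξ → M = MeshMA.metricTensor θ J →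
        r₁ = ρ₁ ⟪x, e₁⟫_ℝ → r₂ = ρ₂ ⟪x, e₂⟫_ℝ →
        ⟪x, e₁⟫_ℝ = MeshMA.cumulativeInv ρ₁ (θ₁ * ⟪ξ, e₁⟫_ℝ) ∧
        ⟪x, e₂⟫_ℝ = MeshMA.cumulativeInv ρ₂ (θ₂ * ⟪ξ, e₂⟫_ℝ) ∧
        J = (θ₁ / r₁) • MeshMA.outer e₁ + (θ₂ / r₂) • MeshMA.outer e₂ ∧
        J *ᵥ e₁.ofLp = (θ₁ / r₁) • e₁.ofLp ∧
        J *ᵥ e₂.ofLp = (θ₂ / r₂) • e₂.ofLp ∧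
        M = θ • (((θ₁ / r₁) ^ 2)⁻¹ • MeshMA.outer e₁ + ((θ₂ / r₂) ^ 2)⁻¹ • MeshMA.outer e₂) ∧
        M = (θ₂ * r₁ ^ 2 / θ₁) • MeshMA.outer e₁ + (θ₁ * r₂ ^ 2 / θ₂) • MeshMA.outer e₂ ∧
        M *ᵥ e₁.ofLp = (θ₂ * r₁ ^ 2 / θ₁) • e₁.ofLp ∧
        M *ᵥ e₂.ofLp = (θ₁ * r₂ ^ 2 / θ₂) • e₂.ofLp ∧
        (∀ N : Matrix (Fin 2) (Fin 2) ℝ, Jᵀ * N * J = θ • (1 : Matrix (Fin 2) (Fin 2) ℝ) ↔ N = M) ∧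
        Real.sqrt M.det = ρ x ∧
        -- the axes of each mesh element are parallel to the feature lines through its centre
        (∀ r : ℝ, 0 < r → MeshMA.meshElement J x r =
          MeshMA.axisEllipse x e₁ e₂ (r * (θ₁ / r₁)) (r * (θ₂ / r₂))) ∧
        MeshMA.featureLine e₁ ⟪x, e₁⟫_ℝ =
          (AffineSubspace.mk' x (Submodule.span ℝ {e₂}) : Set MeshMA.Plane) ∧
        MeshMA.featureLine e₂ ⟪x, e₂⟫_ℝ =
          (AffineSubspace.mk' x (Submodule.span ℝ {e₁}) : Set MeshMA.Plane)) ∧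
      -- the map carries lines of the computational domain exactly onto the feature lines
      (∀ c : ℝ, gradient P '' MeshMA.featureLine e₁ (MeshMA.cumulative ρ₁ c / θ₁) =
        MeshMA.featureLine e₁ c) ∧
      (∀ d : ℝ, gradient P '' MeshMA.featureLine e₂ (MeshMA.cumulative ρ₂ d / θ₂) =
        MeshMA.featureLine e₂ d) := by
  have hm₁ : MeshMA.IsMean ρ₁ T₁ θ₁ := hθ₁
  have hm₂ : MeshMA.IsMean ρ₂ T₂ θ₂ := hθ₂
  have hb₁ := MeshMA.bijective_cumulative hρ₁ hpos₁ hT₁ hper₁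
  have hb₂ := MeshMA.bijective_cumulative hρ₂ hpos₂ hT₂ hper₂
  have hθ₁0 : 0 < θ₁ := MeshMA.mean_pos hρ₁ hpos₁ hT₁ hm₁
  have hθ₂0 : 0 < θ₂ := MeshMA.mean_pos hρ₂ hpos₂ hT₂ hm₂
  have hlat₁ : ∀ w ∈ MeshMA.periodLattice b, Function.Periodic ρ₁ ⟪w, e₁⟫_ℝ := fun w hw =>
    MeshMA.periodic_left_factor he hρ₁ hpos₁ hpos₂ hT₁ hper₁ hρ hper hw
  have hlat₂ : ∀ w ∈ MeshMA.periodLattice b, Function.Periodic ρ₂ ⟪w, e₂⟫_ℝ := fun w hw =>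
    MeshMA.periodic_right_factor he hρ₂ hpos₁ hpos₂ hT₂ hper₂ hρ hper hw
  have hmul : MeshMA.equidistConst b ρ = θ₁ * θ₂ :=
    MeshMA.equidistConst_eq_mul he hρ₁ hρ₂ hT₁ hT₂ hper₁ hper₂ hρ hper hlat₂ hm₁ hm₂
  have hF := MeshMA.hasDerivAt_potential hρ₁ hpos₁ hb₁ (θ := θ₁)
  have hG := MeshMA.hasDerivAt_potential hρ₂ hpos₂ hb₂ (θ := θ₂)
  have hF' := MeshMA.hasDerivAt_meshMap hρ₁ hpos₁ hb₁ (θ := θ₁)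
  have hG' := MeshMA.hasDerivAt_meshMap hρ₂ hpos₂ hb₂ (θ := θ₂)
  have hgrad := MeshMA.gradient_separable (MeshMA.separablePotential_apply e₁ e₂ ρ₁ ρ₂ θ₁ θ₂) hF hG
  have hg₁ : ∀ ξ, ⟪gradient (MeshMA.separablePotential e₁ e₂ ρ₁ ρ₂ θ₁ θ₂) ξ, e₁⟫_ℝ =
      MeshMA.meshMap ρ₁ θ₁ ⟪ξ, e₁⟫_ℝ := fun ξ => by
    rw [hgrad, MeshMA.Frame.inner_combination_left he]
  have hg₂ : ∀ ξ, ⟪gradient (MeshMA.separablePotential e₁ e₂ ρ₁ ρ₂ θ₁ θ₂) ξ, e₂⟫_ℝ =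
      MeshMA.meshMap ρ₂ θ₂ ⟪ξ, e₂⟫_ℝ := fun ξ => by
    rw [hgrad, MeshMA.Frame.inner_combination_right he]
  have hsol := MeshMA.isDoublyPeriodicSolution_separablePotential he hρ₁ hρ₂ hpos₁ hpos₂ hT₁ hT₂
    hper₁ hper₂ hρ hmul hlat₁ hlat₂ hm₁ hm₂
  have hbij := MeshMA.bijective_gradient_separablePotential he hρ₁ hρ₂ hpos₁ hpos₂ hb₁ hb₂
    hθ₁0.ne' hθ₂0.ne'
  refine ⟨hθ.trans hmul, hb₁, hb₂, MeshMA.potential ρ₁ θ₁, MeshMA.potential ρ₂ θ₂,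
    MeshMA.separablePotential e₁ e₂ ρ₁ ρ₂ θ₁ θ₂, fun _ => rfl, hF, hG, ?_, ?_, ?_, ?_, hsol,
    MeshMA.convexOn_separablePotential hρ₁ hρ₂ hpos₁ hpos₂ hb₁ hb₂ hθ₁0 hθ₂0, hbij, ?_, ?_, ?_, ?_⟩
  · intro t
    rw [MeshMA.deriv_potential hρ₁ hpos₁ hb₁, (hF' t).deriv, div_mul_cancel₀ _ (hpos₁ _).ne']
  · intro t
    rw [MeshMA.deriv_potential hρ₂ hpos₂ hb₂, (hG' t).deriv, div_mul_cancel₀ _ (hpos₂ _).ne']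
  · intro t
    rw [MeshMA.deriv_potential hρ₁ hpos₁ hb₁, MeshMA.meshMap_add_period hρ₁ hT₁ hper₁ hm₁ hb₁ hper₁]
  · intro t
    rw [MeshMA.deriv_potential hρ₂ hpos₂ hb₂, MeshMA.meshMap_add_period hρ₂ hT₂ hper₂ hm₂ hb₂ hper₂]
  · intro Q hQ
    refine MeshMA.exists_eq_add_const_of_gradient_eq (hsol.contDiff.differentiable two_ne_zero)
      (hQ.contDiff.differentiable two_ne_zero) fun ξ => ?_
    obtain ⟨h₁, h₂⟩ := MeshMA.equidistDefect_eq_zero he hρ₁ hρ₂ hpos₁ hpos₂ hθ₁0 hθ₂0 hρ hmul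
      (fun w hw => MeshMA.cumulative_add_period hρ₁ hT₁ hper₁ hm₁ (hlat₁ w hw))
      (fun w hw => MeshMA.cumulative_add_period hρ₂ hT₂ hper₂ hm₂ (hlat₂ w hw)) hQ ξ
    -- The vanishing defects say `Rᵢ(∇Q · eᵢ) = θᵢ ξ · eᵢ`, the relation that defines `∇P · eᵢ`.
    apply MeshMA.Frame.ext he
    · rw [hg₁, eq_comm, MeshMA.meshMap_eq_iff hb₁]
      exact sub_eq_zero.1 h₁
    · rw [hg₂, eq_comm, MeshMA.meshMap_eq_iff hb₂]
      exact sub_eq_zero.1 h₂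
  · rintro ξ x J M r₁ r₂ hx rfl rfl hr₁ hr₂
    have hr₁0 : 0 < r₁ := hr₁ ▸ hpos₁ _
    have hr₂0 : 0 < r₂ := hr₂ ▸ hpos₂ _
    have hx₁ : ⟪x, e₁⟫_ℝ = MeshMA.meshMap ρ₁ θ₁ ⟪ξ, e₁⟫_ℝ := hx ▸ hg₁ ξ
    have hx₂ : ⟪x, e₂⟫_ℝ = MeshMA.meshMap ρ₂ θ₂ ⟪ξ, e₂⟫_ℝ := hx ▸ hg₂ ξ
    have hJ : MeshMA.hessianMatrix (MeshMA.separablePotential e₁ e₂ ρ₁ ρ₂ θ₁ θ₂) ξ =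
        MeshMA.frameDiagonal e₁ e₂ (θ₁ / r₁) (θ₂ / r₂) := by
      rw [hr₁, hr₂, hx₁, hx₂]
      exact MeshMA.hessianMatrix_separable hgrad (hF' _) (hG' _)
    have hl₁ : θ₁ / r₁ ≠ 0 := (div_pos hθ₁0 hr₁0).ne'
    have hl₂ : θ₂ / r₂ ≠ 0 := (div_pos hθ₂0 hr₂0).ne'
    have hM := MeshMA.metricTensor_frameDiagonal he hl₁ hl₂ θ
    have hM' : MeshMA.metricTensor θ (MeshMA.frameDiagonal e₁ e₂ (θ₁ / r₁) (θ₂ / r₂)) =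
        MeshMA.frameDiagonal e₁ e₂ (θ₂ * r₁ ^ 2 / θ₁) (θ₁ * r₂ ^ 2 / θ₂) := by
      -- Substituting `θ = θ₁ θ₂` cancels one factor `θᵢ` in each eigenvalue `θ (rᵢ / θᵢ)²`.
      rw [hM, MeshMA.smul_frameDiagonal, hθ, hmul]
      congr 1 <;> field_simp
    rw [hJ]
    refine ⟨hx₁, hx₂, rfl, MeshMA.frameDiagonal_mulVec_left he _ _,
      MeshMA.frameDiagonal_mulVec_right he _ _, hM, hM', ?_, ?_,
      MeshMA.transpose_mul_mul_eq_smul_one_iff ?_ θ, ?_,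
      fun r hr => MeshMA.meshElement_frameDiagonal he hl₁ hl₂ x hr,
      MeshMA.featureLine_left_eq he x, MeshMA.featureLine_right_eq he x⟩
    · rw [hM', MeshMA.frameDiagonal_mulVec_left he]
    · rw [hM', MeshMA.frameDiagonal_mulVec_right he]
    · rw [MeshMA.det_frameDiagonal he]
      exact (mul_ne_zero hl₁ hl₂).isUnit
    · rw [hM', MeshMA.det_frameDiagonal he, hρ, ← hr₁, ← hr₂,
        show θ₂ * r₁ ^ 2 / θ₁ * (θ₁ * r₂ ^ 2 / θ₂) = (r₁ * r₂) ^ 2 by field_simp,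
        Real.sqrt_sq (by positivity)]
  · exact fun c => MeshMA.image_featureLine hb₁ hθ₁0.ne' hbij.2 hg₁ c
  · exact fun d => MeshMA.image_featureLine hb₂ hθ₂0.ne' hbij.2 hg₂ d
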